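/- All systems are finite-dimensional. For a bipartite state $\rho_{AB}$ let $\mathcal{F}(\rho_{AB})$ be the set of states $\operatorname{Tr}_B[\omega_{ABE}]$, where $\omega_{ABE}$ ranges over the states with $E$ isomorphic to $B$ and $\operatorname{Tr}_E[\omega_{ABE}]=\rho_{AB}$. For $\varepsilon\in(0,1)$ let $$D^{\varepsilon}_{\min}(\rho\Vert\sigma) = -\log_2 \inf_{0\le\Lambda\le I}\{\operatorname{Tr}[\Lambda\sigma] : \operatorname{Tr}[\Lambda\rho]\ge 1-\varepsilon\},$$ $$E^{u,\varepsilon}_{\min}(\rho_{AB}) = \inf_{\sigma_{AB}\in\mathcal{F}(\rho_{AB})}\tfrac12 D^{\varepsilon}_{\min}(\rho_{AB}\Vert\sigma_{AB}),\qquad J^{\varepsilon}_{\min}(\rho_{AB}) = 2^{-2E^{u,\varepsilon}_{\min}(\rho_{AB})}.$$ A private state holding $\log_2 k$ bits is a state $\gamma^k_{A'B'A''B''} = V(\Phi^k_{A'B'}\otimes\tau_{A''B''})V^{\dagger}$, where $\Phi^k$ is the maximally entangled state of Schmidt rank $k$ on the $k$-dimensional systems $A'$, $B'$, $\tau$ is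 a state of systems $A''$, $B''$ of arbitrary dimensions, and $V=\sum_{i=0}^{k-1}|i\rangle\langle i|_{A'}\otimes I_{B'}\otimes U^i_{A''B''}$ with unitaries $U^i$. A one-way LOCC channel is a map $\sum_x \mathcal{E}^x\otimes\mathcal{D}^x$ with $\{\mathcal{E}^x\}_x$ a quantum instrument on Alice's side and each $\mathcal{D}^x$ a quantum channel on Bob's side. With the fidelity $F(\rho,\sigma)=(\operatorname{Tr}\sqrt{\sqrt{\sigma}\rho\sqrt{\sigma}})^2$, the one-shot, one-way distillable key $K^{\varepsilon,\to}_D(\rho_{AB})$ is the supremum of $\log_2 k$ over all integers $k\ge 1$, all private states $\gamma^k_{A'B'A''B''}$ holding $\log_2 k$ bits, and all one-way LOCC channels $\mathcal{L}^{\to}_{AB\to A'B'A''B''}$ (Alice holds $A$, $A'$, $A''$ and Bob holds $B$, $B'$, $B''$) with $F(\mathcal{L}^{\to}(\rho_{AB}),\gamma^k_{A'B'A''B''})\ge 1-\varepsilon$. Corollary. Fix $\varepsilon\in(0,1)$ and let $\rho_{AB}$ be a bipartite quantum state such that $$\varepsilon < J^{\varepsilon}_{\min}(\rho_{AB}) \le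 \frac14+\frac{\varepsilon}{2}+\frac{\sqrt{3\varepsilon(1-\varepsilon)}}{2}.$$ Then $$K^{\varepsilon,\to}_D(\rho_{AB}) \le -\log_2\!\left(\sqrt{J^{\varepsilon}_{\min}(\rho_{AB})}-\sqrt{\varepsilon}\right).$$ -/

import Mathlib

open scoped Kronecker MatrixOrder ComplexOrder

noncomputable section

namespace KeyDist

/-! Finite-dimensional quantum systems are index types of orthonormal bases; operators on a system
`a` are the matrices `Matrix a a ℂ`, and the system `AB` has the index type `a × b`. -/

section Basic

variable {a b c d : Type*}
  [Fintype a] [DecidableEq a] [Fintype b] [DecidableEq b]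
  [Fintype c] [DecidableEq c] [Fintype d] [DecidableEq d]

/-- Quantum states: positive semidefinite operators of unit trace. -/
def IsState (ρ : Matrix a a ℂ) : Prop :=
  ρ.PosSemidef ∧ ρ.trace = 1

/-- The fidelity `F(ρ, σ) = (Tr √(√σ ρ √σ))²`. -/
def fidelity (ρ σ : Matrix a a ℂ) : ℝ :=
  ((CFC.sqrt (CFC.sqrt σ * ρ * CFC.sqrt σ)).trace.re) ^ 2

/-- Linear maps between operators on `a` and operators on `b`. -/
abbrev SuperOp (a b : Type*) : Type _ :=
  Matrix a a ℂ →ₗ[ℂ] Matrix b b ℂ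

/-- The tensor product `Φ ⊗ Ψ` of two linear maps on operators,
determined by `(Φ ⊗ Ψ) (X ⊗ Y) = Φ X ⊗ Ψ Y`. -/
def tensorMap (Φ : SuperOp a c) (Ψ : SuperOp b d) : SuperOp (a × b) (c × d) :=
  (kroneckerLinearEquiv c c d d ℂ).toLinearMap ∘ₗ
    TensorProduct.map Φ Ψ ∘ₗ (kroneckerLinearEquiv a a b b ℂ).symm.toLinearMap

theorem tensorMap_kronecker (Φ : SuperOp a c) (Ψ : SuperOp b d)
    (X : Matrix a a ℂ) (Y : Matrix b b ℂ) :
    tensorMap Φ Ψ (X ⊗ₖ Y) = Φ X ⊗ₖ Ψ Y := by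
  simp [tensorMap]

/-- Complete positivity: `id ⊗ Φ` is positive for every dimension of the reference system. -/
def IsCP (Φ : SuperOp a b) : Prop :=
  ∀ (n : ℕ) (M : Matrix (Fin n × a) (Fin n × a) ℂ), M.PosSemidef →
    (tensorMap (LinearMap.id : SuperOp (Fin n) (Fin n)) Φ M).PosSemidef

/-- Trace preservation. -/
def IsTP (Φ : SuperOp a b) : Prop :=
  ∀ X : Matrix a a ℂ, (Φ X).trace = X.trace

/-- Quantum channels: completely positive trace-preserving maps. -/
def IsChannel (Φ : SuperOp a b) : Prop :=
  IsCP Φ ∧ IsTP Φ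

/-- Quantum instruments with outcomes in `Fin N`: completely positive maps whose sum is
trace preserving. -/
def IsInstrument {N : ℕ} (E : Fin N → SuperOp a b) : Prop :=
  (∀ x, IsCP (E x)) ∧ IsTP (∑ x, E x)

/-- One-way LOCC channels `AB → CD` (from the party holding `A`, `C` to the party holding
`B`, `D`): `∑ x, E x ⊗ D x` with an instrument `E` and channels `D x`. -/
def IsOneWayLOCC (L : SuperOp (a × b) (c × d)) : Prop :=
  ∃ (N : ℕ) (E : Fin N → SuperOp a c) (D : Fin N → SuperOp b d),
    IsInstrument E ∧ (∀ x, IsChannel (D x)) ∧ L = ∑ x, tensorMap (E x) (D x)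

/-- The partial trace over `E` of an operator on `ABE`. -/
def traceE (ω : Matrix (a × b × c) (a × b × c) ℂ) : Matrix (a × b) (a × b) ℂ :=
  Matrix.of fun p q => ∑ e, ω (p.1, p.2, e) (q.1, q.2, e)

/-- The partial trace over `B` of an operator on `ABE`. -/
def traceB (ω : Matrix (a × b × c) (a × b × c) ℂ) : Matrix (a × c) (a × c) ℂ :=
  Matrix.of fun p q => ∑ j, ω (p.1, j, p.2) (q.1, j, q.2)

/-- The set `𝓕(ρ_AB)` of the states `Tr_B ω_ABE`, for the extensions `ω_ABE` of `ρ_AB` with `E`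
isomorphic to `B`. -/
def freeStates (ρ : Matrix (a × b) (a × b) ℂ) : Set (Matrix (a × b) (a × b) ℂ) :=
  {σ | ∃ ω : Matrix (a × b × b) (a × b × b) ℂ, IsState ω ∧ traceE ω = ρ ∧ traceB ω = σ}

/-- `inf {Tr[Λσ] : 0 ≤ Λ ≤ I, Tr[Λρ] ≥ 1 - ε}`. -/
def hypTestError (ε : ℝ) (ρ σ : Matrix a a ℂ) : ℝ :=
  sInf {t : ℝ | ∃ Λ : Matrix a a ℂ, Λ.PosSemidef ∧ (1 - Λ).PosSemidef ∧
    1 - ε ≤ (Λ * ρ).trace.re ∧ t = (Λ * σ).trace.re}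

/-- The smooth min-relative entropy (hypothesis testing relative entropy)
`D^ε_min(ρ‖σ) = -log₂ inf {Tr[Λσ] : 0 ≤ Λ ≤ I, Tr[Λρ] ≥ 1 - ε}`, with the value `+∞` if the
infimum is zero. -/
def smoothMinRelEntropy (ε : ℝ) (ρ σ : Matrix a a ℂ) : EReal :=
  -(ENNReal.log (ENNReal.ofReal (hypTestError ε ρ σ)) / ((Real.log 2 : ℝ) : EReal))

/-- The smooth-min unextendible entanglement
`E^{u,ε}_min(ρ_AB) = inf {(1/2) D^ε_min(ρ_AB‖σ_AB) : σ_AB ∈ 𝓕(ρ_AB)}`. -/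
def smoothMinUnextEnt (ε : ℝ) (ρ : Matrix (a × b) (a × b) ℂ) : EReal :=
  ⨅ σ ∈ freeStates ρ, ((1 / 2 : ℝ) : EReal) * smoothMinRelEntropy ε ρ σ

/-- `J^ε_min(ρ_AB) = 2 ^ (-2 E^{u,ε}_min(ρ_AB))`, where `2 ^ (-∞) = 0`. -/
def Jmin (ε : ℝ) (ρ : Matrix (a × b) (a × b) ℂ) : ℝ :=
  (EReal.exp (((Real.log 2 : ℝ) : EReal) *
    (((-2 : ℝ) : EReal) * smoothMinUnextEnt ε ρ))).toReal

end Basic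

section PrivateStates

variable {k m n : ℕ}

/-- The maximally entangled state `Φ^k = (1/k) ∑ i j, |i⟩⟨j| ⊗ |i⟩⟨j|`. -/
def maxEntangled (k : ℕ) : Matrix (Fin k × Fin k) (Fin k × Fin k) ℂ :=
  (k : ℂ)⁻¹ • ∑ i : Fin k, ∑ j : Fin k,
    (Matrix.single i j (1 : ℂ)) ⊗ₖ (Matrix.single i j (1 : ℂ))

/-- The twisting operator `∑ i, |i⟩⟨i| ⊗ I ⊗ U i` on the key systems `Fin k × Fin k` and the
shield systems `Fin m × Fin n`. -/
def twisting (U : Fin k → Matrix (Fin m × Fin n) (Fin m × Fin n) ℂ) :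
    Matrix ((Fin k × Fin k) × (Fin m × Fin n)) ((Fin k × Fin k) × (Fin m × Fin n)) ℂ :=
  ∑ i : Fin k, (Matrix.single i i (1 : ℂ) ⊗ₖ (1 : Matrix (Fin k) (Fin k) ℂ)) ⊗ₖ U i

/-- Bipartite private states holding `log₂ k` bits: `V (Φ^k ⊗ τ) V†` with a state `τ` of the
shield systems and a twisting unitary `V`, the four systems being regrouped as
(Alice's key, Alice's shield), (Bob's key, Bob's shield). -/
def IsPrivateState
    (γ : Matrix ((Fin k × Fin m) × (Fin k × Fin n)) ((Fin k × Fin m) × (Fin k × Fin n)) ℂ) :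
    Prop :=
  ∃ (τ : Matrix (Fin m × Fin n) (Fin m × Fin n) ℂ)
    (U : Fin k → Matrix (Fin m × Fin n) (Fin m × Fin n) ℂ),
    IsState τ ∧ (∀ i, U i ∈ Matrix.unitaryGroup (Fin m × Fin n) ℂ) ∧
    γ = Matrix.reindex (Equiv.prodProdProdComm (Fin k) (Fin k) (Fin m) (Fin n))
      (Equiv.prodProdProdComm (Fin k) (Fin k) (Fin m) (Fin n))
      (twisting U * (maxEntangled k ⊗ₖ τ) * (twisting U).conjTranspose)

end PrivateStates

/-- The one-shot, one-way distillable key `K^{ε,→}_D(ρ_AB)`: the supremum of `log₂ k` over all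
positive integers `k`, all private states `γ` holding `log₂ k` bits (with shields of any
dimensions) and all one-way LOCC channels `L` with `F(L ρ, γ) ≥ 1 - ε`. -/
def distillableKey {a b : Type*} [Fintype a] [DecidableEq a] [Fintype b] [DecidableEq b]
    (ε : ℝ) (ρ : Matrix (a × b) (a × b) ℂ) : EReal :=
  sSup {r : EReal | ∃ (k m n : ℕ)
    (γ : Matrix ((Fin k × Fin m) × (Fin k × Fin n)) ((Fin k × Fin m) × (Fin k × Fin n)) ℂ)
    (L : SuperOp (a × b) ((Fin k × Fin m) × (Fin k × Fin n))),
    1 ≤ k ∧ IsPrivateState γ ∧ IsOneWayLOCC L ∧ 1 - ε ≤ fidelity (L ρ) γ ∧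
    r = ((Real.logb 2 k : ℝ) : EReal)}

end KeyDist

end

open scoped Kronecker MatrixOrder ComplexOrder

noncomputable section

set_option linter.unusedSectionVars false

namespace KeyDist

/-! ### Trace inequalities for projective tests and fidelity. -/

section Trace

open scoped Matrix.Norms.Frobenius
open Matrix

variable {m n : Type*} [Fintype m] [Fintype n]

/-! The bound is a monogamy statement: Alice cannot pass the same private-state test with Bob and
with a copy of Bob.

Let `L = ∑ x, E x ⊗ D x` distill a private state from `ρ`, and let `ω` on `ABE` extend `ρ` with
other marginal `σ`. Applying `D x` to both `B` and `E` gives a state `Ω` whose marginals are `L ρ`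
and `L σ` (`traceE_sum_tensorMap`, `traceB_sum_tensorMap`). A private state is supported on the
range of an isometry `V`, so `V Vᴴ` is a test that `L ρ` passes with probability at least the
fidelity, hence at least `1 - ε` (`fidelity_le_trace_projection`).

Let `Q` and `P` be this test on Alice–Bob and on Alice–copy. Unitarity of the twisting gives `Q P Q
= k⁻² Q` (`privateIsometry_overlap`), so `Ω` passes `P` with probability at most `(1/k + √ε)²`
(`trace_projection_le`). Pulled back through `L` (`exists_pullback`), the test is admissible in the
hypothesis-testing infimum for `ρ` against every free `σ`. Hence `J ≤ (1/k + √ε)²`, which is solved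
for `k`. -/

theorem frobenius_norm_sq (A : Matrix m n ℂ) : ‖A‖ ^ 2 = (Aᴴ * A).trace.re := by
  rw [Matrix.frobenius_norm_def, ← Real.sqrt_eq_rpow, Real.sq_sqrt (by positivity),
    Finset.sum_comm, Matrix.trace, Complex.re_sum]
  refine Finset.sum_congr rfl fun i _ => ?_
  rw [Matrix.diag_apply, Matrix.mul_apply, Complex.re_sum]
  refine Finset.sum_congr rfl fun j _ => ?_
  rw [Matrix.conjTranspose_apply, Complex.star_def, ← Complex.normSq_eq_conj_mul_self,
    Complex.ofReal_re, Complex.normSq_eq_norm_sq, Real.rpow_two]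

/-- Cauchy–Schwarz for the Hilbert–Schmidt inner product. -/
theorem norm_trace_mul_le (A : Matrix m n ℂ) (B : Matrix n m ℂ) :
    ‖(A * B).trace‖ ≤ ‖A‖ * ‖B‖ := by
  rw [← Matrix.frobenius_norm_transpose B]
  simp only [Matrix.frobenius_norm_def, ← Real.sqrt_eq_rpow, Matrix.trace, Matrix.diag_apply,
    Matrix.mul_apply, Real.rpow_two, ← Finset.sum_product', Finset.univ_product_univ]
  refine (norm_sum_le _ _).trans ?_
  simp only [norm_mul]
  exact Real.sum_mul_le_sqrt_mul_sqrt _ (fun x : m × n => ‖A x.1 x.2‖) fun x => ‖Bᵀ x.1 x.2‖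

theorem projection_posSemidef {P : Matrix n n ℂ} (hP : P.IsHermitian) (hP2 : P * P = P) :
    P.PosSemidef := by
  have h := posSemidef_conjTranspose_mul_self P
  rwa [hP.eq, hP2] at h

variable [DecidableEq n]

theorem sqrt_mul_sqrt {A : Matrix n n ℂ} (hA : A.PosSemidef) :
    CFC.sqrt A * CFC.sqrt A = A :=
  CFC.sqrt_mul_sqrt_self A hA.nonneg

theorem sqrt_posSemidef (A : Matrix n n ℂ) : (CFC.sqrt A).PosSemidef :=
  (CFC.sqrt_nonneg A).posSemidef

theorem sqrt_conjTranspose (A : Matrix n n ℂ) : (CFC.sqrt A)ᴴ = CFC.sqrt A :=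
  (sqrt_posSemidef A).isHermitian

theorem trace_mul_posSemidef_nonneg {A B : Matrix n n ℂ} (hA : A.PosSemidef)
    (hB : B.PosSemidef) : 0 ≤ (A * B).trace := by
  rw [← sqrt_mul_sqrt hB, ← mul_assoc, Matrix.trace_mul_comm, ← mul_assoc]
  have := (hA.mul_mul_conjTranspose_same (CFC.sqrt B)).trace_nonneg
  rwa [sqrt_conjTranspose] at this

theorem trace_mul_re_le {A B ω : Matrix n n ℂ} (h : (B - A).PosSemidef) (hω : ω.PosSemidef) :
    (A * ω).trace.re ≤ (B * ω).trace.re := by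
  have := (Complex.le_def.1 (trace_mul_posSemidef_nonneg h hω)).1
  rw [sub_mul, Matrix.trace_sub] at this
  simpa using this

/-- The Frobenius norm of `A √ω`. -/
theorem frobenius_norm_mul_sqrt_sq (A : Matrix m n ℂ) {ω : Matrix n n ℂ} (hω : ω.PosSemidef) :
    ‖A * CFC.sqrt ω‖ ^ 2 = (Aᴴ * A * ω).trace.re := by
  rw [frobenius_norm_sq, conjTranspose_mul, sqrt_conjTranspose, Matrix.mul_assoc, Matrix.trace_mul_comm,
    Matrix.mul_assoc, Matrix.mul_assoc, sqrt_mul_sqrt hω, Matrix.mul_assoc]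

theorem one_sub_projection_posSemidef {P : Matrix n n ℂ} (hP : P.IsHermitian) (hP2 : P * P = P) :
    (1 - P).PosSemidef := by
  have h := posSemidef_conjTranspose_mul_self (1 - P)
  have h2 : (1 - P)ᴴ * (1 - P) = 1 - P := by
    rw [conjTranspose_sub, conjTranspose_one, hP.eq, sub_mul, mul_sub, mul_sub, hP2]
    simp
  rwa [h2] at h

/-- If a state passes the test `Q` with probability at least `1 - ε` and the projections `P`, `Q`
satisfy `Q P Q ≤ c²`, then the state passes the test `P` with probability at most `(c + √ε)²`. -/
theorem trace_projection_le {P Q ω : Matrix n n ℂ} {c ε : ℝ} (hω : IsState ω)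
    (hP : P.IsHermitian) (hP2 : P * P = P) (hQ : Q.IsHermitian) (hQ2 : Q * Q = Q) (hc : 0 ≤ c)
    (hPQ : (((c ^ 2 : ℝ) : ℂ) • (1 : Matrix n n ℂ) - Q * P * Q).PosSemidef)
    (hε : 1 - ε ≤ (Q * ω).trace.re) : (P * ω).trace.re ≤ (c + √ε) ^ 2 := by
  have hQ' : (1 - Q)ᴴ = 1 - Q := by rw [conjTranspose_sub, conjTranspose_one, hQ.eq]
  have hQQ : (1 - Q) * (1 - Q) = 1 - Q := by
    rw [sub_mul, mul_sub, mul_sub, hQ2]; simp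
  -- Pass probabilities are squared norms of vectors `A √ω`. Splitting `P = P Q + P (1 - Q)` and
  -- using the triangle inequality, the overlap bounds the first term by `c` and failure of `Q`
  -- bounds the second by `√ε`.
  have h0 : ‖P * CFC.sqrt ω‖ ^ 2 = (P * ω).trace.re := by
    rw [frobenius_norm_mul_sqrt_sq _ hω.1, hP.eq, hP2]
  have h1 : ‖P * Q * CFC.sqrt ω‖ ≤ c := by
    refine abs_le_of_sq_le_sq' ?_ hc |>.2
    rw [frobenius_norm_mul_sqrt_sq _ hω.1, conjTranspose_mul, hP.eq, hQ.eq]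
    have e : Q * P * (P * Q) = Q * P * Q := by rw [← mul_assoc, mul_assoc Q P P, hP2]
    rw [e]
    refine (trace_mul_re_le hPQ hω.1).trans ?_
    rw [smul_mul_assoc, one_mul, Matrix.trace_smul, hω.2, smul_eq_mul, mul_one, Complex.ofReal_re]
  have h2 : ‖P * (1 - Q) * CFC.sqrt ω‖ ≤ √ε := by
    refine Real.le_sqrt_of_sq_le ?_
    rw [frobenius_norm_mul_sqrt_sq _ hω.1, conjTranspose_mul, hP.eq, hQ']
    have e : (1 - Q) * P * (P * (1 - Q)) = (1 - Q) * P * (1 - Q) := by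
      rw [← mul_assoc, mul_assoc (1 - Q) P P, hP2]
    rw [e]
    have h3 : ((1 - Q) - (1 - Q) * P * (1 - Q)).PosSemidef := by
      have := (one_sub_projection_posSemidef hP hP2).conjTranspose_mul_mul_same (1 - Q)
      rwa [hQ', mul_sub (1 - Q), sub_mul, mul_one, hQQ] at this
    refine (trace_mul_re_le h3 hω.1).trans ?_
    rw [sub_mul, one_mul, Matrix.trace_sub, hω.2, Complex.sub_re, Complex.one_re]
    linarith
  rw [← h0]
  have h4 : P * CFC.sqrt ω = P * Q * CFC.sqrt ω + P * (1 - Q) * CFC.sqrt ω := by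
    rw [← add_mul, ← mul_add, add_sub_cancel, mul_one]
  have h5 := norm_add_le (P * Q * CFC.sqrt ω) (P * (1 - Q) * CFC.sqrt ω)
  rw [← h4] at h5
  gcongr
  linarith

/-- A polar decomposition `√(Aᴴ A) = W A` with a contraction `W`. -/
theorem exists_polar (A : Matrix n n ℂ) :
    ∃ W : Matrix n n ℂ, CFC.sqrt (Aᴴ * A) = W * A ∧ (1 - W * Wᴴ).PosSemidef := by
  set S := CFC.sqrt (Aᴴ * A) with hS
  have hSS : S * S = Aᴴ * A := sqrt_mul_sqrt (posSemidef_conjTranspose_mul_self A)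
  have hSh : S.IsHermitian := (sqrt_posSemidef _).isHermitian
  -- `T` is the pseudo-inverse of `S`: eigenvalues are inverted with `0⁻¹ = 0`, so `T S² T` is the
  -- support projection of `S`.
  obtain ⟨T, hT, h1, h2⟩ : ∃ T : Matrix n n ℂ, T.IsHermitian ∧ T * (S * S) = S ∧
      (1 - T * (S * S) * T).PosSemidef := by
    obtain ⟨U, d, hU, hd⟩ : ∃ (U : Matrix n n ℂ) (d : n → ℝ), U ∈ unitaryGroup n ℂ ∧
        S = U * diagonal (fun i => (d i : ℂ)) * Uᴴ :=
      ⟨hSh.eigenvectorUnitary, hSh.eigenvalues, hSh.eigenvectorUnitary.2,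
        by
          simpa [Unitary.conjStarAlgAut_apply, Function.comp_def, star_eq_conjTranspose]
            using hSh.spectral_theorem⟩
    have hUU : Uᴴ * U = 1 := (mem_unitaryGroup_iff').1 hU
    have hUU' : U * Uᴴ = 1 := (mem_unitaryGroup_iff).1 hU
    have key : ∀ f g : n → ℂ, (U * diagonal f * Uᴴ) * (U * diagonal g * Uᴴ) =
        U * diagonal (fun i => f i * g i) * Uᴴ := fun f g => by
      rw [← diagonal_mul_diagonal]
      calc _ = U * diagonal f * (Uᴴ * U) * diagonal g * Uᴴ := by simp only [mul_assoc]
        _ = _ := by rw [hUU, mul_one]; simp only [mul_assoc]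
    refine ⟨U * diagonal (fun i => ((d i)⁻¹ : ℂ)) * Uᴴ, ?_, ?_, ?_⟩
    · refine isHermitian_mul_mul_conjTranspose U ?_
      refine isHermitian_diagonal_of_self_adjoint _ ?_
      ext i; simp
    · rw [hd, key, key]
      congr; ext i
      by_cases h : (d i : ℂ) = 0
      · simp [h]
      · field_simp
    · rw [hd, key, key, key]
      have : (1 : Matrix n n ℂ) = U * diagonal (fun _ => 1) * Uᴴ := by simp [hUU']
      rw [this, ← sub_mul, ← mul_sub, diagonal_sub]
      refine PosSemidef.mul_mul_conjTranspose_same ?_ U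
      refine PosSemidef.diagonal fun i => ?_
      by_cases h : (d i : ℂ) = 0
      · simp [h]
      · have : (d i : ℂ)⁻¹ * (d i * d i) * (d i : ℂ)⁻¹ = 1 := by field_simp
        simp [this]
  refine ⟨T * Aᴴ, ?_, ?_⟩
  · rw [mul_assoc, ← hSS, h1]
  · rw [conjTranspose_mul, conjTranspose_conjTranspose, hT.eq]
    have : T * Aᴴ * (A * T) = T * (S * S) * T := by rw [hSS]; simp only [mul_assoc]
    rwa [this]

/-- The fidelity to a state supported in the range of a projection is bounded by the probability
of passing the corresponding test. -/
theorem fidelity_le_trace_projection {P ρ σ : Matrix n n ℂ} (hρ : ρ.PosSemidef) (hσ : IsState σ)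
    (hP : P.IsHermitian) (hP2 : P * P = P) (hPσ : P * σ = σ) :
    fidelity ρ σ ≤ (P * ρ).trace.re := by
  have hPs : P * CFC.sqrt σ = CFC.sqrt σ := by
    have h0 : ((1 - P) * CFC.sqrt σ) * ((1 - P) * CFC.sqrt σ)ᴴ = 0 := by
      rw [conjTranspose_mul, sqrt_conjTranspose, mul_assoc, ← mul_assoc (CFC.sqrt σ),
        sqrt_mul_sqrt hσ.1, ← mul_assoc, sub_mul, hPσ]
      simp
    rw [self_mul_conjTranspose_eq_zero, sub_mul, one_mul, sub_eq_zero] at h0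
    exact h0.symm
  obtain ⟨W, hW, hW1⟩ := exists_polar (CFC.sqrt ρ * CFC.sqrt σ)
  have e1 : (CFC.sqrt ρ * CFC.sqrt σ)ᴴ * (CFC.sqrt ρ * CFC.sqrt σ) =
      CFC.sqrt σ * ρ * CFC.sqrt σ := by
    rw [conjTranspose_mul, sqrt_conjTranspose, sqrt_conjTranspose, mul_assoc,
      ← mul_assoc (CFC.sqrt ρ), sqrt_mul_sqrt hρ, ← mul_assoc]
  -- Inserting `P` in front of `√σ` prepares Cauchy–Schwarz: `√ρ P` carries the pass probability,
  -- and `√σ W` has norm at most 1 because `W` is a contraction.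
  have e2 : (W * (CFC.sqrt ρ * CFC.sqrt σ)).trace =
      ((CFC.sqrt ρ * P) * (CFC.sqrt σ * W)).trace := by
    rw [Matrix.trace_mul_comm]
    conv_lhs => rw [← hPs]
    simp only [mul_assoc]
  have b1 : ‖CFC.sqrt ρ * P‖ ^ 2 = (P * ρ).trace.re := by
    rw [frobenius_norm_sq, conjTranspose_mul, sqrt_conjTranspose, hP.eq, mul_assoc,
      ← mul_assoc (CFC.sqrt ρ), sqrt_mul_sqrt hρ, Matrix.trace_mul_comm, mul_assoc, hP2,
      Matrix.trace_mul_comm]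
  have b2 : ‖CFC.sqrt σ * W‖ ^ 2 ≤ 1 := by
    rw [← Matrix.frobenius_norm_conjTranspose, frobenius_norm_sq, conjTranspose_conjTranspose,
      conjTranspose_mul, sqrt_conjTranspose, mul_assoc, Matrix.trace_mul_comm, ← mul_assoc,
      mul_assoc, sqrt_mul_sqrt hσ.1]
    refine (trace_mul_re_le hW1 hσ.1).trans ?_
    rw [one_mul, hσ.2, Complex.one_re]
  rw [fidelity, ← e1, hW, e2, ← b1]
  have b3 : |(CFC.sqrt ρ * P * (CFC.sqrt σ * W)).trace.re| ≤ ‖CFC.sqrt ρ * P‖ :=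
    calc _ ≤ _ := Complex.abs_re_le_norm _
      _ ≤ _ := norm_trace_mul_le _ _
      _ ≤ ‖CFC.sqrt ρ * P‖ * 1 := by
        gcongr
        exact abs_le_of_sq_le_sq' (by simpa using b2) zero_le_one |>.2
      _ = _ := mul_one _
  rw [← sq_abs]
  gcongr

end Trace

/-! ### Kraus representations, trace preservation and pulled-back tests. -/

section SuperOperators

open Matrix

variable {a b c d : Type*}
  [Fintype a] [DecidableEq a] [Fintype b] [DecidableEq b]
  [Fintype c] [DecidableEq c] [Fintype d] [DecidableEq d]

/-- Product operators span, so identities between maps on composite systems need checking only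
there. -/
theorem linearMap_ext_kronecker {V : Type*} [AddCommMonoid V] [Module ℂ V]
    {f g : Matrix (a × b) (a × b) ℂ →ₗ[ℂ] V}
    (h : ∀ (X : Matrix a a ℂ) (Y : Matrix b b ℂ), f (X ⊗ₖ Y) = g (X ⊗ₖ Y)) : f = g := by
  have h' : f ∘ₗ (kroneckerLinearEquiv a a b b ℂ).toLinearMap =
      g ∘ₗ (kroneckerLinearEquiv a a b b ℂ).toLinearMap :=
    TensorProduct.ext' fun X Y => by simpa using h X Y
  exact (LinearMap.cancel_right (kroneckerLinearEquiv a a b b ℂ).surjective).1 h'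

theorem linearMap_ext_kronecker₃ {V : Type*} [AddCommMonoid V] [Module ℂ V]
    {f g : Matrix (a × b × c) (a × b × c) ℂ →ₗ[ℂ] V}
    (h : ∀ (X : Matrix a a ℂ) (Y : Matrix b b ℂ) (Z : Matrix c c ℂ),
      f (X ⊗ₖ (Y ⊗ₖ Z)) = g (X ⊗ₖ (Y ⊗ₖ Z))) : f = g := by
  refine linearMap_ext_kronecker fun X W => ?_
  have : f ∘ₗ kroneckerMapBilinear (LinearMap.mul ℂ ℂ) X =
      g ∘ₗ kroneckerMapBilinear (LinearMap.mul ℂ ℂ) X :=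
    linearMap_ext_kronecker fun Y Z => h X Y Z
  exact LinearMap.congr_fun this W

/-- The map `X ↦ K X Kᴴ`. -/
def conjMap (K : Matrix b a ℂ) : SuperOp a b :=
  (mulRightLinearMap b ℂ Kᴴ).comp (mulLeftLinearMap a ℂ K)

@[simp]
theorem conjMap_apply (K : Matrix b a ℂ) (X : Matrix a a ℂ) : conjMap K X = K * X * Kᴴ := rfl

/-- The maps that are sums of maps `X ↦ K X Kᴴ`. -/
def HasKraus (Φ : SuperOp a b) : Prop :=
  ∃ (r : Type) (_ : Fintype r) (K : r → Matrix b a ℂ), Φ = ∑ i, conjMap (K i)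

theorem HasKraus.posSemidef {Φ : SuperOp a b} (h : HasKraus Φ) {X : Matrix a a ℂ}
    (hX : X.PosSemidef) : (Φ X).PosSemidef := by
  obtain ⟨r, _, K, rfl⟩ := h
  rw [LinearMap.sum_apply]
  exact posSemidef_sum _ fun i _ => hX.mul_mul_conjTranspose_same (K i)

/-- Products of Kraus operators are Kraus operators. This gives positivity when both factors act
nontrivially, whereas `IsCP` only covers an idle reference. -/
theorem HasKraus.tensorMap {Φ : SuperOp a c} {Ψ : SuperOp b d} (hΦ : HasKraus Φ)
    (hΨ : HasKraus Ψ) : HasKraus (tensorMap Φ Ψ) := by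
  obtain ⟨r, _, K, rfl⟩ := hΦ
  obtain ⟨s, _, K', rfl⟩ := hΨ
  refine ⟨r × s, inferInstance, fun x => K x.1 ⊗ₖ K' x.2, linearMap_ext_kronecker fun X Y => ?_⟩
  rw [tensorMap_kronecker]
  simp only [LinearMap.sum_apply, conjMap_apply, Fintype.sum_prod_type, conjTranspose_kronecker,
    ← mul_kronecker_mul]
  change kroneckerMapBilinear (LinearMap.mul ℂ ℂ) (∑ x, K x * X * (K x)ᴴ) _ = _
  simp only [map_sum, LinearMap.sum_apply]
  rw [Finset.sum_comm]
  rfl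

/-- Completely positive maps have Kraus operators. -/
theorem IsCP.hasKraus {Φ : SuperOp a b} (h : IsCP Φ) : HasKraus Φ := by
  let e := Fintype.equivFin a
  -- The unnormalized maximally entangled vector, with the reference copy of `a` relabelled by `Fin`
  -- as `IsCP` requires.
  let v : Matrix (Fin (Fintype.card a) × a) Unit ℂ := of fun p _ => if p.1 = e p.2 then 1 else 0
  have hv : v * vᴴ = ∑ i : a, ∑ j : a, single (e i) (e j) (1 : ℂ) ⊗ₖ single i j (1 : ℂ) := by
    ext ⟨p, i⟩ ⟨q, j⟩
    simp [v, mul_apply, Matrix.sum_apply, kroneckerMap_apply, single_apply, ite_and,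
      Finset.sum_ite_eq, eq_comm]
    split_ifs <;> rfl
  have hC := h _ (v * vᴴ) (posSemidef_self_mul_conjTranspose v)
  -- The Choi matrix; the columns of its square root, reshaped into matrices, are the Kraus
  -- operators.
  set C := KeyDist.tensorMap LinearMap.id Φ (v * vᴴ) with hCdef
  have hent : ∀ i j p q, C (e i, p) (e j, q) = Φ (single i j 1) p q := by
    intro i j p q
    rw [hCdef, hv]
    simp [map_sum, tensorMap_kronecker, Matrix.sum_apply, kroneckerMap_apply, single_apply,
      ite_and]
  have hB := CFC.sqrt_mul_sqrt_self C hC.nonneg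
  set B := CFC.sqrt C
  have hBh : Bᴴ = B := (CFC.sqrt_nonneg C).posSemidef.isHermitian
  -- Relabelling by `Fin` puts the Kraus index in `Type`, whatever the universe of `b`.
  let f := Fintype.equivFin (Fin (Fintype.card a) × b)
  refine ⟨Fin (Fintype.card (Fin (Fintype.card a) × b)), inferInstance,
    fun r => of fun p i => B (e i, p) (f.symm r), ?_⟩
  refine Matrix.ext_linearMap ℂ fun i j => LinearMap.ext_ring ?_
  ext p q
  simp only [LinearMap.comp_apply, singleLinearMap_apply, LinearMap.sum_apply, conjMap_apply,
    Matrix.sum_apply]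
  rw [f.symm.sum_comp fun r => ((of fun p i => B (e i, p) r : Matrix b a ℂ) * single i j (1 : ℂ) *
    (of fun p i => B (e i, p) r : Matrix b a ℂ)ᴴ) p q, ← hent, ← hB, Matrix.mul_apply]
  refine Finset.sum_congr rfl fun r _ => ?_
  have : B r (e j, q) = star (B (e j, q) r) := by rw [← conjTranspose_apply, hBh]
  rw [this]
  simp [mul_apply, single_apply, ite_and]

theorem IsTP.tensorMap {Φ : SuperOp a c} {Ψ : SuperOp b d} (hΦ : IsTP Φ) (hΨ : IsTP Ψ) :
    IsTP (tensorMap Φ Ψ) := by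
  have : traceLinearMap (c × d) ℂ ℂ ∘ₗ KeyDist.tensorMap Φ Ψ = traceLinearMap (a × b) ℂ ℂ :=
    linearMap_ext_kronecker fun X Y => by
      simp [tensorMap_kronecker, trace_kronecker, hΦ X, hΨ Y]
  exact fun X => LinearMap.congr_fun this X

/-- `∑ x, Φ x ⊗ Ψ x` is trace preserving for an instrument `Φ` and channels `Ψ x`. -/
theorem isTP_sum_tensorMap {N : ℕ} {Φ : Fin N → SuperOp a c} {Ψ : Fin N → SuperOp b d}
    (hΦ : IsTP (∑ x, Φ x)) (hΨ : ∀ x, IsTP (Ψ x)) : IsTP (∑ x, tensorMap (Φ x) (Ψ x)) := by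
  have : traceLinearMap (c × d) ℂ ℂ ∘ₗ (∑ x, KeyDist.tensorMap (Φ x) (Ψ x)) =
      traceLinearMap (a × b) ℂ ℂ :=
    linearMap_ext_kronecker fun X Y => by
      have := hΦ X
      rw [LinearMap.sum_apply, trace_sum] at this
      simp [tensorMap_kronecker, trace_kronecker, fun x => hΨ x Y, ← Finset.sum_mul, this]
  exact fun X => LinearMap.congr_fun this X

theorem hasKraus_sum {N : ℕ} {Φ : Fin N → SuperOp a b} (h : ∀ x, HasKraus (Φ x)) :
    HasKraus (∑ x, Φ x) := by
  choose r hr K hK using h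
  refine ⟨Σ x, r x, inferInstance, fun x => K x.1 x.2, ?_⟩
  rw [Fintype.sum_sigma]
  exact Finset.sum_congr rfl fun x _ => hK x

/-- Self-duality of the positive cone: rank-one `X` recover the quadratic form of `A`. -/
theorem posSemidef_of_trace_mul_nonneg {A : Matrix a a ℂ}
    (h : ∀ X : Matrix a a ℂ, X.PosSemidef → 0 ≤ (A * X).trace) : A.PosSemidef := by
  rw [← isPositive_toEuclideanLin_iff, LinearMap.isPositive_iff_complex]
  intro x
  have h1 := h _ (posSemidef_vecMulVec_self_star x.ofLp)
  have h2 : inner ℂ (A.toEuclideanLin x) x = star (A * vecMulVec x.ofLp (star x.ofLp)).trace := by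
    rw [mul_vecMulVec, trace_vecMulVec]
    simp [PiLp.inner_apply, dotProduct, toLpLin_apply, mul_comm]
  rw [h2]
  obtain ⟨hr, hi⟩ := Complex.le_def.1 h1
  refine ⟨?_, by simpa using hr⟩
  apply Complex.ext <;> simp
  simpa using hi.symm

/-- A test on the output of a positive trace-preserving map is equivalent to a test on its
input. -/
theorem exists_pullback {L : SuperOp a b} (hL : ∀ X, X.PosSemidef → (L X).PosSemidef)
    (hTP : IsTP L) {P : Matrix b b ℂ} (hP : P.PosSemidef) (hP1 : (1 - P).PosSemidef) :
    ∃ Λ : Matrix a a ℂ, Λ.PosSemidef ∧ (1 - Λ).PosSemidef ∧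
      ∀ X, (Λ * X).trace = (P * L X).trace := by
  -- The adjoint of `L` applied to `P`, read off on matrix units.
  let Λ : Matrix a a ℂ := of fun i j => (P * L (single j i 1)).trace
  have hΛ : ∀ X, (Λ * X).trace = (P * L X).trace := by
    have : traceLinearMap a ℂ ℂ ∘ₗ mulLeftLinearMap a ℂ Λ =
        traceLinearMap b ℂ ℂ ∘ₗ mulLeftLinearMap b ℂ P ∘ₗ L := by
      refine Matrix.ext_linearMap ℂ fun i j => LinearMap.ext_ring ?_
      simp [trace_mul_single, Λ]
    exact fun X => LinearMap.congr_fun this X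
  refine ⟨Λ, posSemidef_of_trace_mul_nonneg fun X hX => ?_,
    posSemidef_of_trace_mul_nonneg fun X hX => ?_, hΛ⟩
  · rw [hΛ]
    exact trace_mul_posSemidef_nonneg hP (hL X hX)
  · rw [sub_mul, one_mul, trace_sub, hΛ, ← hTP X]
    have := trace_mul_posSemidef_nonneg hP1 (hL X hX)
    rwa [sub_mul, one_mul, trace_sub] at this

end SuperOperators

/-! ### Partial traces of three-party extensions. -/

section Extensions

open Matrix

variable {a b c d : Type*}
  [Fintype a] [DecidableEq a] [Fintype b] [DecidableEq b]
  [Fintype c] [DecidableEq c] [Fintype d] [DecidableEq d]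

/-- `traceE` as a linear map. -/
def traceELinearMap : SuperOp (a × b × c) (a × b) where
  toFun := traceE
  map_add' X Y := by ext; simp [traceE, Finset.sum_add_distrib]
  map_smul' r X := by ext; simp [traceE, Finset.mul_sum]

/-- `traceB` as a linear map. -/
def traceBLinearMap : SuperOp (a × b × c) (a × c) where
  toFun := traceB
  map_add' X Y := by ext; simp [traceB, Finset.sum_add_distrib]
  map_smul' r X := by ext; simp [traceB, Finset.mul_sum]

theorem traceE_kronecker (X : Matrix a a ℂ) (Y : Matrix b b ℂ) (Z : Matrix c c ℂ) :
    traceE (X ⊗ₖ (Y ⊗ₖ Z)) = Z.trace • X ⊗ₖ Y := by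
  ext ⟨i, j⟩ ⟨i', j'⟩
  simp only [traceE, of_apply, kroneckerMap_apply, Matrix.smul_apply, smul_eq_mul, Matrix.trace,
    diag_apply, Finset.sum_mul]
  exact Finset.sum_congr rfl fun e _ => by ring

theorem traceB_kronecker (X : Matrix a a ℂ) (Y : Matrix b b ℂ) (Z : Matrix c c ℂ) :
    traceB (X ⊗ₖ (Y ⊗ₖ Z)) = Y.trace • X ⊗ₖ Z := by
  ext ⟨i, j⟩ ⟨i', j'⟩
  simp only [traceB, of_apply, kroneckerMap_apply, Matrix.smul_apply, smul_eq_mul, Matrix.trace,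
    diag_apply, Finset.sum_mul]
  exact Finset.sum_congr rfl fun e _ => by ring

/-- Each `Ψ x` preserves the trace, so processing the copy before discarding it has no effect. -/
theorem traceE_sum_tensorMap {N : ℕ} (Φ : Fin N → SuperOp a c) {Ψ : Fin N → SuperOp b d}
    (hΨ : ∀ x, IsTP (Ψ x)) (ω : Matrix (a × b × b) (a × b × b) ℂ) :
    traceE ((∑ x, tensorMap (Φ x) (tensorMap (Ψ x) (Ψ x))) ω) =
      (∑ x, tensorMap (Φ x) (Ψ x)) (traceE ω) := by
  have : traceELinearMap ∘ₗ (∑ x, tensorMap (Φ x) (tensorMap (Ψ x) (Ψ x))) =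
      (∑ x, tensorMap (Φ x) (Ψ x)) ∘ₗ traceELinearMap :=
    linearMap_ext_kronecker₃ fun X Y Z => by
      simp only [LinearMap.comp_apply, LinearMap.sum_apply, tensorMap_kronecker, map_sum]
      change ∑ x, traceE _ = ∑ x, tensorMap (Φ x) (Ψ x) (traceE _)
      simp [traceE_kronecker, tensorMap_kronecker, fun x => hΨ x Z]
  exact LinearMap.congr_fun this ω

theorem traceB_sum_tensorMap {N : ℕ} (Φ : Fin N → SuperOp a c) {Ψ : Fin N → SuperOp b d}
    (hΨ : ∀ x, IsTP (Ψ x)) (ω : Matrix (a × b × b) (a × b × b) ℂ) :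
    traceB ((∑ x, tensorMap (Φ x) (tensorMap (Ψ x) (Ψ x))) ω) =
      (∑ x, tensorMap (Φ x) (Ψ x)) (traceB ω) := by
  have : traceBLinearMap ∘ₗ (∑ x, tensorMap (Φ x) (tensorMap (Ψ x) (Ψ x))) =
      (∑ x, tensorMap (Φ x) (Ψ x)) ∘ₗ traceBLinearMap :=
    linearMap_ext_kronecker₃ fun X Y Z => by
      simp only [LinearMap.comp_apply, LinearMap.sum_apply, tensorMap_kronecker, map_sum]
      change ∑ x, traceB _ = ∑ x, tensorMap (Φ x) (Ψ x) (traceB _)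
      simp [traceB_kronecker, tensorMap_kronecker, fun x => hΨ x Y]
  exact LinearMap.congr_fun this ω

/-- The regrouping of `ABE` as `(AE)B`. -/
def regroupE (a b c : Type*) : a × b × c ≃ (a × c) × b where
  toFun p := ((p.1, p.2.2), p.2.1)
  invFun p := (p.1.1, p.2, p.1.2)
  left_inv _ := rfl
  right_inv _ := rfl

theorem trace_submatrix_equiv (e : a ≃ b) (X : Matrix b b ℂ) :
    (X.submatrix e e).trace = X.trace :=
  e.sum_comp fun i => X i i

/-- The adjoint of a partial trace tensors with the identity, so a test on a marginal becomes a test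
on the whole extension. -/
theorem trace_mul_traceE (P : Matrix (a × b) (a × b) ℂ)
    (ω : Matrix (a × b × c) (a × b × c) ℂ) :
    (P * traceE ω).trace = ((P ⊗ₖ (1 : Matrix c c ℂ)).submatrix
      (Equiv.prodAssoc a b c).symm (Equiv.prodAssoc a b c).symm * ω).trace := by
  have : traceLinearMap (a × b) ℂ ℂ ∘ₗ mulLeftLinearMap (a × b) ℂ P ∘ₗ traceELinearMap =
      traceLinearMap (a × b × c) ℂ ℂ ∘ₗ mulLeftLinearMap (a × b × c) ℂ
        ((P ⊗ₖ (1 : Matrix c c ℂ)).submatrix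
          (Equiv.prodAssoc a b c).symm (Equiv.prodAssoc a b c).symm) :=
    linearMap_ext_kronecker₃ fun X Y Z => by
      simp only [LinearMap.comp_apply, mulLeftLinearMap_apply, traceLinearMap_apply]
      change (P * traceE _).trace = _
      have h : X ⊗ₖ (Y ⊗ₖ Z) = ((X ⊗ₖ Y) ⊗ₖ Z).submatrix (Equiv.prodAssoc a b c).symm
          (Equiv.prodAssoc a b c).symm := by
        ext ⟨i, j, k⟩ ⟨i', j', k'⟩
        simp [mul_assoc]
      rw [traceE_kronecker, h, submatrix_mul_equiv, trace_submatrix_equiv, ← mul_kronecker_mul,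
        one_mul, trace_kronecker, mul_smul_comm, trace_smul, smul_eq_mul, mul_comm]
  exact LinearMap.congr_fun this ω

theorem trace_mul_traceB (P : Matrix (a × c) (a × c) ℂ)
    (ω : Matrix (a × b × c) (a × b × c) ℂ) :
    (P * traceB ω).trace = ((P ⊗ₖ (1 : Matrix b b ℂ)).submatrix
      (regroupE a b c) (regroupE a b c) * ω).trace := by
  have : traceLinearMap (a × c) ℂ ℂ ∘ₗ mulLeftLinearMap (a × c) ℂ P ∘ₗ traceBLinearMap =
      traceLinearMap (a × b × c) ℂ ℂ ∘ₗ mulLeftLinearMap (a × b × c) ℂ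
        ((P ⊗ₖ (1 : Matrix b b ℂ)).submatrix (regroupE a b c) (regroupE a b c)) :=
    linearMap_ext_kronecker₃ fun X Y Z => by
      simp only [LinearMap.comp_apply, mulLeftLinearMap_apply, traceLinearMap_apply]
      change (P * traceB _).trace = _
      have h : X ⊗ₖ (Y ⊗ₖ Z) = ((X ⊗ₖ Z) ⊗ₖ Y).submatrix (regroupE a b c) (regroupE a b c) := by
        ext ⟨i, j, k⟩ ⟨i', j', k'⟩
        simp [regroupE]
        ring
      rw [traceB_kronecker, h, submatrix_mul_equiv, trace_submatrix_equiv, ← mul_kronecker_mul,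
        one_mul, trace_kronecker, mul_smul_comm, trace_smul, smul_eq_mul, mul_comm]
  exact LinearMap.congr_fun this ω

theorem submatrix_kronecker_one_mul_conjTranspose {s : Type*} [Fintype s] (e : d ≃ a × b)
    (V : Matrix a s ℂ) :
    (V ⊗ₖ (1 : Matrix b b ℂ)).submatrix e id * ((V ⊗ₖ (1 : Matrix b b ℂ)).submatrix e id)ᴴ =
      ((V * Vᴴ) ⊗ₖ (1 : Matrix b b ℂ)).submatrix e e := by
  rw [conjTranspose_submatrix, ← submatrix_mul _ _ e id e Function.bijective_id,
    conjTranspose_kronecker, conjTranspose_one, ← mul_kronecker_mul, one_mul]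

theorem conjTranspose_mul_submatrix_kronecker_one {s : Type*} (e : d ≃ a × b)
    (V : Matrix a s ℂ) :
    ((V ⊗ₖ (1 : Matrix b b ℂ)).submatrix e id)ᴴ * (V ⊗ₖ (1 : Matrix b b ℂ)).submatrix e id =
      (Vᴴ * V) ⊗ₖ (1 : Matrix b b ℂ) := by
  rw [conjTranspose_submatrix, submatrix_mul_equiv, conjTranspose_kronecker, conjTranspose_one,
    ← mul_kronecker_mul, one_mul, submatrix_id_id]

end Extensions

/-! ### Geometry of private states. -/

section PrivateStates

open Matrix

variable {k m n : ℕ}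

/-- The isometry `(1/√k) ∑ i, |i⟩ ⊗ |i⟩ ⊗ U i` from the shield systems to all systems of a private
state. -/
def privateIsometry (U : Fin k → Matrix (Fin m × Fin n) (Fin m × Fin n) ℂ) :
    Matrix ((Fin k × Fin m) × (Fin k × Fin n)) (Fin m × Fin n) ℂ :=
  of fun p t => if p.1.1 = p.2.1 then ((√k)⁻¹ : ℝ) * U p.1.1 (p.1.2, p.2.2) t else 0

theorem inv_sqrt_mul_self (k : ℕ) : (((√k)⁻¹ : ℝ) : ℂ) * (((√k)⁻¹ : ℝ) : ℂ) = (k : ℂ)⁻¹ := by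
  rw [← Complex.ofReal_mul, ← mul_inv, Real.mul_self_sqrt (by positivity)]
  simp

theorem sum_conj_mul_of_mem_unitary {s : Type*} [Fintype s] [DecidableEq s] {U : Matrix s s ℂ}
    (hU : U ∈ unitaryGroup s ℂ) (i j : s) : ∑ t, star (U t i) * U t j = if i = j then 1 else 0 := by
  have := congr_fun₂ (mem_unitaryGroup_iff'.1 hU) i j
  simpa [mul_apply, one_apply] using this

theorem sum_mul_conj_of_mem_unitary {s : Type*} [Fintype s] [DecidableEq s] {U : Matrix s s ℂ}
    (hU : U ∈ unitaryGroup s ℂ) (i j : s) : ∑ t, U i t * star (U j t) = if i = j then 1 else 0 := by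
  have := congr_fun₂ (mem_unitaryGroup_iff.1 hU) i j
  simpa [mul_apply, one_apply] using this

/-- Each of the `k` unitaries contributes the identity with weight `1/k`. -/
theorem privateIsometry_isometry (hk : 1 ≤ k)
    {U : Fin k → Matrix (Fin m × Fin n) (Fin m × Fin n) ℂ}
    (hU : ∀ i, U i ∈ unitaryGroup (Fin m × Fin n) ℂ) :
    (privateIsometry U)ᴴ * privateIsometry U = 1 := by
  ext t t'
  have hk' : (k : ℂ) ≠ 0 := by exact_mod_cast (by omega : k ≠ 0)
  have h : ∀ i, ∑ x, ∑ y, ((((√k)⁻¹ : ℝ) : ℂ) * star (U i (x, y) t)) *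
      ((((√k)⁻¹ : ℝ) : ℂ) * U i (x, y) t') = (k : ℂ)⁻¹ * if t = t' then 1 else 0 := fun i => by
    rw [← sum_conj_mul_of_mem_unitary (hU i), ← inv_sqrt_mul_self, Finset.mul_sum,
      Fintype.sum_prod_type]
    refine Finset.sum_congr rfl fun x _ => Finset.sum_congr rfl fun y _ => by ring
  calc _ = ∑ i, ∑ x, ∑ y, ((((√k)⁻¹ : ℝ) : ℂ) * star (U i (x, y) t)) *
      ((((√k)⁻¹ : ℝ) : ℂ) * U i (x, y) t') := by
        simp only [mul_apply, Fintype.sum_prod_type, conjTranspose_apply, privateIsometry, of_apply]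
        refine Finset.sum_congr rfl fun i _ => Finset.sum_congr rfl fun x _ => ?_
        rw [Finset.sum_comm]
        refine Finset.sum_congr rfl fun y _ => ?_
        rw [Finset.sum_eq_single i (fun j _ hj => by simp [hj.symm]) (by simp)]
        simp
    _ = _ := by
      simp only [h]
      simp [one_apply, hk']

/-- A private state is the image of a shield state under the isometry `privateIsometry`. -/
theorem reindex_twisting (U : Fin k → Matrix (Fin m × Fin n) (Fin m × Fin n) ℂ)
    (τ : Matrix (Fin m × Fin n) (Fin m × Fin n) ℂ) :
    reindex (Equiv.prodProdProdComm (Fin k) (Fin k) (Fin m) (Fin n))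
      (Equiv.prodProdProdComm (Fin k) (Fin k) (Fin m) (Fin n))
      (twisting U * (maxEntangled k ⊗ₖ τ) * (twisting U)ᴴ) =
    privateIsometry U * τ * (privateIsometry U)ᴴ := by
  obtain ⟨c, hc⟩ : ∃ c : ℂ, c = (((√k)⁻¹ : ℝ) : ℂ) := ⟨_, rfl⟩
  have hcs : star c = c := by rw [hc]; exact Complex.conj_ofReal _
  have hcc : (k : ℂ)⁻¹ = c * c := by rw [hc, inv_sqrt_mul_self]
  -- `W` appends the maximally entangled vector to a shield vector; twisting it gives
  -- `privateIsometry U`.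
  let W : Matrix ((Fin k × Fin k) × (Fin m × Fin n)) (Fin m × Fin n) ℂ :=
    of fun p t => if p.1.1 = p.1.2 then (if p.2 = t then c else 0) else 0
  have h1 : maxEntangled k ⊗ₖ τ = W * τ * Wᴴ := by
    ext ⟨⟨i, i'⟩, s⟩ ⟨⟨j, j'⟩, t⟩
    have e : maxEntangled k (i, i') (j, j') =
        if i = i' then (if j = j' then c * c else 0) else 0 := by
      simp [maxEntangled, Matrix.sum_apply, kroneckerMap_apply, single_apply, ite_and, hcc]
      grind
    have e1 : ∀ x, (W * τ) ((i, i'), s) x = if i = i' then c * τ s x else 0 := fun x => by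
      by_cases h : i = i' <;> simp [W, mul_apply, h]
    rw [kroneckerMap_apply, e, mul_apply]
    simp only [e1, conjTranspose_apply, W, of_apply, apply_ite star, hcs, star_zero]
    by_cases h : i = i' <;> by_cases h' : j = j' <;> simp [h, h']
    ring
  have h2 : twisting U * W = (privateIsometry U).submatrix
      (Equiv.prodProdProdComm (Fin k) (Fin k) (Fin m) (Fin n)) id := by
    ext ⟨⟨i, i'⟩, s⟩ t
    have e : ∀ j j' p, twisting U ((i, i'), s) ((j, j'), p) =
        if i = j then (if i' = j' then U i s p else 0) else 0 := fun j j' p => by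
      simp [twisting, Matrix.sum_apply, kroneckerMap_apply, single_apply, one_apply, ite_and]
      grind
    rw [mul_apply, Fintype.sum_prod_type, Fintype.sum_prod_type]
    simp only [e, W, of_apply, submatrix_apply, id, privateIsometry,
      Equiv.prodProdProdComm_apply, ← hc]
    by_cases h : i = i'
    · subst h
      simp [mul_comm]
    · simp [h, Ne.symm h]
  rw [h1]
  have h3 : twisting U * (W * τ * Wᴴ) * (twisting U)ᴴ =
      (twisting U * W) * τ * (twisting U * W)ᴴ := by
    simp only [conjTranspose_mul, Matrix.mul_assoc]
  rw [h3, h2]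
  ext p q
  simp [mul_apply]

/-- The projections of two copies of `privateIsometry` with the first party in common. -/
theorem privateIsometry_overlap {U : Fin k → Matrix (Fin m × Fin n) (Fin m × Fin n) ℂ}
    (hU : ∀ i, U i ∈ unitaryGroup (Fin m × Fin n) ℂ) :
    let R := ((privateIsometry U) ⊗ₖ (1 : Matrix (Fin k × Fin n) (Fin k × Fin n) ℂ)).submatrix
      (Equiv.prodAssoc _ _ _).symm id
    let T := ((privateIsometry U) ⊗ₖ (1 : Matrix (Fin k × Fin n) (Fin k × Fin n) ℂ)).submatrix
      (regroupE (Fin k × Fin m) (Fin k × Fin n) (Fin k × Fin n)) id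
    (Rᴴ * T) * (Rᴴ * T)ᴴ = ((k : ℂ)⁻¹ ^ 2) • 1 := by
  intro R T
  -- Alice's key index is shared, so both Bob-side key indices must agree with it. What remains is a
  -- block for each `j`: a rearrangement of the entries of `U j`, scaled by `1/k`.
  have hM : ∀ g j y g' j' y', (Rᴴ * T) (g, (j, y)) (g', (j', y')) = if j = j' then
      (k : ℂ)⁻¹ * ∑ x, star (U j (x, y') g) * U j (x, y) g' else 0 := by
    intro g j y g' j' y'
    have h1 : (Rᴴ * T) (g, j, y) (g', j', y') =
        ∑ p, star (privateIsometry U (p, j', y') g) * privateIsometry U (p, j, y) g' := by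
      rw [mul_apply, Fintype.sum_prod_type]
      refine Finset.sum_congr rfl fun p _ => ?_
      rw [Fintype.sum_prod_type, Finset.sum_eq_single (j', y') (fun q _ hq => ?_) (by simp),
        Finset.sum_eq_single (j, y) (fun q _ hq => ?_) (by simp)]
      · simp [R, T, regroupE]
      · simp [R, one_apply_ne hq]
      · simp [T, regroupE, one_apply_ne hq]
    rw [h1, Fintype.sum_prod_type]
    simp only [privateIsometry, of_apply]
    rw [Finset.sum_eq_single j' (fun i _ hi => by simp [hi]) (by simp)]
    by_cases h : j = j'
    · subst h
      simp only [if_true, ← inv_sqrt_mul_self, Finset.mul_sum, star_mul', Complex.star_def,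
        Complex.conj_ofReal]
      exact Finset.sum_congr rfl fun x _ => by ring
    · simp [h, Ne.symm h]
  ext ⟨g, j, y⟩ ⟨g₂, j₂, y₂⟩
  -- Unitarity is used twice: orthonormal rows of `U j` collapse the sum over `g'`, then orthonormal
  -- columns collapse the rest.
  have key : ∑ g', ∑ y', (∑ x, star (U j (x, y') g) * U j (x, y) g') *
      star (∑ x, star (U j (x, y') g₂) * U j (x, y₂) g') =
      if g = g₂ ∧ y = y₂ then 1 else 0 := by
    calc _ = ∑ g', ∑ y', ∑ x, ∑ x₂, (star (U j (x, y') g) * U j (x₂, y') g₂) *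
          (U j (x, y) g' * star (U j (x₂, y₂) g')) := by
          refine Finset.sum_congr rfl fun g' _ => Finset.sum_congr rfl fun y' _ => ?_
          rw [star_sum, Finset.sum_mul_sum]
          refine Finset.sum_congr rfl fun x _ => Finset.sum_congr rfl fun x₂ _ => ?_
          rw [star_mul', star_star]
          ring
      _ = ∑ y', ∑ x, ∑ x₂, (star (U j (x, y') g) * U j (x₂, y') g₂) *
          ∑ g', (U j (x, y) g' * star (U j (x₂, y₂) g')) := by
          rw [Finset.sum_comm]
          refine Finset.sum_congr rfl fun y' _ => ?_
          rw [Finset.sum_comm]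
          refine Finset.sum_congr rfl fun x _ => ?_
          rw [Finset.sum_comm]
          exact Finset.sum_congr rfl fun x₂ _ => (Finset.mul_sum ..).symm
      _ = if y = y₂ then ∑ p, star (U j p g) * U j p g₂ else 0 := by
          simp only [sum_mul_conj_of_mem_unitary (hU j), Prod.mk.injEq]
          by_cases h : y = y₂
          · simp [h, Fintype.sum_prod_type_right]
          · simp [h]
      _ = _ := by
          rw [sum_conj_mul_of_mem_unitary (hU j)]
          by_cases h : y = y₂ <;> simp [h]
  have hs : ((Rᴴ * T) * (Rᴴ * T)ᴴ) (g, j, y) (g₂, j₂, y₂) = if j = j₂ then (k : ℂ)⁻¹ ^ 2 *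
      ∑ g', ∑ y', (∑ x, star (U j (x, y') g) * U j (x, y) g') *
      star (∑ x, star (U j (x, y') g₂) * U j (x, y₂) g') else 0 := by
    rw [mul_apply, Fintype.sum_prod_type]
    by_cases h : j = j₂
    · subst h
      rw [if_pos rfl, Finset.mul_sum]
      refine Finset.sum_congr rfl fun g' _ => ?_
      rw [Fintype.sum_prod_type, Finset.mul_sum]
      simp only [conjTranspose_apply, hM]
      rw [Finset.sum_eq_single j (fun i _ hi => by simp [hi.symm]) (by simp)]
      refine Finset.sum_congr rfl fun y' _ => ?_
      have : star ((k : ℂ)⁻¹) = (k : ℂ)⁻¹ := by simp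
      simp only [if_true, star_mul', this]
      ring
    · rw [if_neg h]
      refine Finset.sum_eq_zero fun g' _ => Finset.sum_eq_zero fun i _ => ?_
      rw [conjTranspose_apply, hM, hM]
      by_cases h1 : j = i.1
      · rw [if_neg fun h2 : j₂ = i.1 => h (h1.trans h2.symm), star_zero, mul_zero]
      · rw [if_neg h1, zero_mul]
  rw [hs, key, Matrix.smul_apply, one_apply]
  by_cases h : j = j₂ <;> by_cases h1 : g = g₂ <;> by_cases h2 : y = y₂ <;> simp [h, h1, h2]

end PrivateStates

/-! ### From the overlap bound to the key bound. -/

section Main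

open Matrix

variable {a b : Type*} [Fintype a] [DecidableEq a] [Fintype b] [DecidableEq b]

/-- A bound on the probability that any extension passes the test of a private state. -/
theorem hypTestError_le {k m n : ℕ} {ε : ℝ} {ρ σ : Matrix (a × b) (a × b) ℂ}
    {γ : Matrix ((Fin k × Fin m) × (Fin k × Fin n)) ((Fin k × Fin m) × (Fin k × Fin n)) ℂ}
    {L : SuperOp (a × b) ((Fin k × Fin m) × (Fin k × Fin n))} (hk : 1 ≤ k)
    (hγ : IsPrivateState γ) (hL : IsOneWayLOCC L) (hF : 1 - ε ≤ fidelity (L ρ) γ)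
    (hρ : IsState ρ) (hσ : σ ∈ freeStates ρ) :
    hypTestError ε ρ σ ≤ ((k : ℝ)⁻¹ + √ε) ^ 2 := by
  obtain ⟨τ, U, hτ, hU, rfl⟩ := hγ
  obtain ⟨N, Φ, Ψ, ⟨hΦ, hΦTP⟩, hΨ, rfl⟩ := hL
  obtain ⟨ω, hω, hωρ, hωσ⟩ := hσ
  rw [reindex_twisting] at hF
  set V := privateIsometry U with hV
  have hVV : Vᴴ * V = 1 := privateIsometry_isometry hk hU
  have hΨK := fun x => (hΨ x).1.hasKraus
  have hLpos : ∀ X, X.PosSemidef → ((∑ x, tensorMap (Φ x) (Ψ x)) X).PosSemidef := fun X hX =>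
    (hasKraus_sum fun x => (hΦ x).hasKraus.tensorMap (hΨK x)).posSemidef hX
  have hPh : (V * Vᴴ).IsHermitian := isHermitian_mul_conjTranspose_self V
  have hPP : (V * Vᴴ) * (V * Vᴴ) = V * Vᴴ := by
    rw [Matrix.mul_assoc, ← Matrix.mul_assoc Vᴴ, hVV, Matrix.one_mul]
  have hγs : IsState (V * τ * Vᴴ) := by
    refine ⟨hτ.1.mul_mul_conjTranspose_same V, ?_⟩
    rw [Matrix.mul_assoc, Matrix.trace_mul_comm, Matrix.mul_assoc, hVV, Matrix.mul_one, hτ.2]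
  have hF2 := hF.trans (fidelity_le_trace_projection (hLpos ρ hρ.1) hγs hPh hPP (by
    simp only [Matrix.mul_assoc]
    rw [← Matrix.mul_assoc Vᴴ V, hVV, Matrix.one_mul]))
  obtain ⟨Λ, hΛ, hΛ1, hΛt⟩ := exists_pullback hLpos (isTP_sum_tensorMap hΦTP fun x => (hΨ x).2)
    (projection_posSemidef hPh hPP) (one_sub_projection_posSemidef hPh hPP)
  have hmem : hypTestError ε ρ σ ≤ (Λ * σ).trace.re := by
    -- The real infimum needs a lower bound; 0 works since `σ`, a marginal of a state, is positive.
    refine csInf_le ⟨0, ?_⟩ ⟨Λ, hΛ, hΛ1, by rwa [hΛt], rfl⟩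
    rintro _ ⟨Λ', h, -, -, rfl⟩
    refine (Complex.le_def.1 (trace_mul_posSemidef_nonneg h ?_)).1
    rw [← hωσ]
    refine posSemidef_of_trace_mul_nonneg fun X hX => ?_
    rw [Matrix.trace_mul_comm, trace_mul_traceB]
    exact trace_mul_posSemidef_nonneg ((hX.kronecker PosSemidef.one).submatrix _) hω.1
  refine hmem.trans ?_
  rw [hΛt, ← hωσ, ← traceB_sum_tensorMap Φ fun x => (hΨ x).2, trace_mul_traceB]
  rw [← hωρ, ← traceE_sum_tensorMap Φ fun x => (hΨ x).2, trace_mul_traceE] at hF2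
  set Ω := (∑ x, tensorMap (Φ x) (tensorMap (Ψ x) (Ψ x))) ω
  have hΩ : IsState Ω := by
    refine ⟨(hasKraus_sum fun x => (hΦ x).hasKraus.tensorMap
      ((hΨK x).tensorMap (hΨK x))).posSemidef hω.1, ?_⟩
    rw [isTP_sum_tensorMap hΦTP (fun x => (hΨ x).2.tensorMap (hΨ x).2) ω, hω.2]
  have hov := privateIsometry_overlap hU
  rw [← hV] at hov
  set R := (V ⊗ₖ (1 : Matrix (Fin k × Fin n) (Fin k × Fin n) ℂ)).submatrix
      (Equiv.prodAssoc _ _ _).symm id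
  set T := (V ⊗ₖ (1 : Matrix (Fin k × Fin n) (Fin k × Fin n) ℂ)).submatrix
      (regroupE (Fin k × Fin m) (Fin k × Fin n) (Fin k × Fin n)) id
  have hRR : Rᴴ * R = 1 := by
    rw [conjTranspose_mul_submatrix_kronecker_one, hVV, one_kronecker_one]
  have hTT : Tᴴ * T = 1 := by
    rw [conjTranspose_mul_submatrix_kronecker_one, hVV, one_kronecker_one]
  rw [← submatrix_kronecker_one_mul_conjTranspose]
  rw [← submatrix_kronecker_one_mul_conjTranspose] at hF2
  have idem : ∀ {A : Matrix ((Fin k × Fin m) × (Fin k × Fin n) × (Fin k × Fin n))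
      ((Fin m × Fin n) × (Fin k × Fin n)) ℂ}, Aᴴ * A = 1 → (A * Aᴴ) * (A * Aᴴ) = A * Aᴴ := by
    intro A hA
    rw [Matrix.mul_assoc, ← Matrix.mul_assoc Aᴴ, hA, Matrix.one_mul]
  refine trace_projection_le hΩ (isHermitian_mul_conjTranspose_self T) (idem hTT)
    (isHermitian_mul_conjTranspose_self R) (idem hRR) (by positivity) ?_ hF2
  -- `R Rᴴ` is the Alice–Bob test and `T Tᴴ` the Alice–copy test, so their overlap is governed by
  -- `Rᴴ T`; this gives `c = 1/k`.
  have e : R * Rᴴ * (T * Tᴴ) * (R * Rᴴ) = ((k : ℂ)⁻¹ ^ 2) • (R * Rᴴ) := by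
    have : R * Rᴴ * (T * Tᴴ) * (R * Rᴴ) = R * ((Rᴴ * T) * (Rᴴ * T)ᴴ) * Rᴴ := by
      simp only [conjTranspose_mul, conjTranspose_conjTranspose, Matrix.mul_assoc]
    rw [this, hov, Matrix.mul_smul, Matrix.mul_one, Matrix.smul_mul]
  rw [e, show (((k : ℝ)⁻¹ ^ 2 : ℝ) : ℂ) = (k : ℂ)⁻¹ ^ 2 by push_cast; rfl, ← smul_sub]
  refine (one_sub_projection_posSemidef (isHermitian_mul_conjTranspose_self R)
    (idem hRR)).smul ?_
  rw [show (k : ℂ)⁻¹ ^ 2 = (((k : ℝ)⁻¹ ^ 2 : ℝ) : ℂ) by push_cast; rfl]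
  exact_mod_cast (by positivity : (0 : ℝ) ≤ (k : ℝ)⁻¹ ^ 2)

/-- `J` undoes the logarithm and the factor 1/2, and the infimum over free states becomes a uniform
bound. Positivity of `c` keeps `log c` finite in `EReal`. -/
theorem Jmin_le {ε c : ℝ} {ρ : Matrix (a × b) (a × b) ℂ} (hc : 0 < c)
    (h : ∀ σ ∈ freeStates ρ, hypTestError ε ρ σ ≤ c) : Jmin ε ρ ≤ c := by
  have hl : 0 < Real.log 2 := Real.log_pos one_lt_two
  have h1 : ((-(Real.log c / Real.log 2) / 2 : ℝ) : EReal) ≤ smoothMinUnextEnt ε ρ := by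
    refine le_iInf₂ fun σ hσ => ?_
    have h2 : ((-(Real.log c / Real.log 2) : ℝ) : EReal) ≤ smoothMinRelEntropy ε ρ σ := by
      rw [smoothMinRelEntropy, EReal.coe_neg, EReal.neg_le_neg_iff, EReal.coe_div]
      refine EReal.div_le_div_right_of_nonneg (by exact_mod_cast hl.le) ?_
      rw [← ENNReal.log_ofReal_of_pos hc]
      exact ENNReal.log_monotone (ENNReal.ofReal_le_ofReal (h σ hσ))
    calc ((-(Real.log c / Real.log 2) / 2 : ℝ) : EReal)
        = ((1 / 2 : ℝ) : EReal) * ((-(Real.log c / Real.log 2) : ℝ) : EReal) := by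
          rw [← EReal.coe_mul]; congr 1; ring
      _ ≤ _ := mul_le_mul_of_nonneg_left h2 (by exact_mod_cast (by norm_num : (0 : ℝ) ≤ 1 / 2))
  have h3 : ((Real.log 2 : ℝ) : EReal) * (((-2 : ℝ) : EReal) * smoothMinUnextEnt ε ρ) ≤
      ((Real.log c : ℝ) : EReal) := by
    have h4 : ((-2 : ℝ) : EReal) * smoothMinUnextEnt ε ρ ≤
        ((Real.log c / Real.log 2 : ℝ) : EReal) := by
      rw [EReal.coe_neg, EReal.neg_mul]
      refine EReal.neg_le_of_neg_le ?_
      calc _ = ((2 : ℝ) : EReal) * ((-(Real.log c / Real.log 2) / 2 : ℝ) : EReal) := by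
            rw [← EReal.coe_neg, ← EReal.coe_mul]; congr 1; ring
        _ ≤ _ := mul_le_mul_of_nonneg_left h1 (by exact_mod_cast zero_le_two)
    calc _ ≤ ((Real.log 2 : ℝ) : EReal) * ((Real.log c / Real.log 2 : ℝ) : EReal) :=
          mul_le_mul_of_nonneg_left h4 (by exact_mod_cast hl.le)
      _ = _ := by rw [← EReal.coe_mul, mul_div_cancel₀ _ hl.ne']
  have h5 := EReal.exp_monotone h3
  rw [EReal.exp_coe, Real.exp_log hc] at h5
  exact ENNReal.toReal_le_of_le_ofReal hc.le h5

end Main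

end KeyDist

end

theorem corollary1 {a b : Type*} [Fintype a] [DecidableEq a] [Fintype b] [DecidableEq b]
    (ε : ℝ) (hε : ε ∈ Set.Ioo (0 : ℝ) 1)
    (ρ : Matrix (a × b) (a × b) ℂ) (hρ : KeyDist.IsState ρ)
    (hJ_lower : ε < KeyDist.Jmin ε ρ)
    (hJ_upper : KeyDist.Jmin ε ρ ≤ 1 / 4 + ε / 2 + Real.sqrt (3 * ε * (1 - ε)) / 2) :
    KeyDist.distillableKey ε ρ ≤
      ((-Real.logb 2 (Real.sqrt (KeyDist.Jmin ε ρ) - Real.sqrt ε) : ℝ) : EReal) := by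
  refine sSup_le ?_
  rintro _ ⟨k, m, n, γ, L, hk, hγ, hL, hF, rfl⟩
  have hk0 : (0 : ℝ) < k := by exact_mod_cast hk
  have hJ := KeyDist.Jmin_le (c := ((k : ℝ)⁻¹ + √ε) ^ 2) (by positivity)
    fun σ hσ => KeyDist.hypTestError_le hk hγ hL hF hρ hσ
  have h1 : √(KeyDist.Jmin ε ρ) ≤ (k : ℝ)⁻¹ + √ε := Real.sqrt_le_iff.2 ⟨by positivity, hJ⟩
  -- The lower bound on `J` makes the argument of the logarithm positive, so monotonicity applies.
  have h2 : 0 < √(KeyDist.Jmin ε ρ) - √ε := sub_pos.2 (Real.sqrt_lt_sqrt hε.1.le hJ_lower)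
  have h3 : Real.logb 2 (√(KeyDist.Jmin ε ρ) - √ε) ≤ Real.logb 2 (k : ℝ)⁻¹ :=
    Real.logb_le_logb_of_le one_lt_two h2 (by linarith)
  rw [Real.logb_inv] at h3
  exact EReal.coe_le_coe_iff.2 (by linarith)
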